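/- Let $q\ge 2$, and let $M,K\in\mathbb R^{n\times n}$ be symmetric positive definite. For $i,j\in\{1,\dots,q\}$ let $D_{ij},R_{ij}\in\mathbb R^{n\times n}$ be symmetric positive semidefinite matrices with $D_{ij}=D_{ji}$, $R_{ij}=R_{ji}$, $D_{ii}=R_{ii}=0$. Assume that the eigenvalues $\sigma_1,\dots,\sigma_n$ of $P:=M^{-1/2}KM^{-1/2}$ are distinct, and let $v_1,\dots,v_n\in\mathbb R^n$ be corresponding unit eigenvectors. Let $L_{\rm d}\in\mathbb R^{qn\times qn}$ be the matrix-weighted Laplacian with weights $W_{ij}=M^{-1/2}D_{ij}M^{-1/2}$, i.e. the $q\times q$ block matrix whose $i$-th diagonal block is $\sum_j W_{ij}$ and whose $(i,j)$ block is $-W_{ij}$ for $i\ne j$. For $k=1,\dots,n$ put $$G_{kk}=[I_q\otimes v_k^T]\,L_{\rm d}\,[I_q\otimes v_k]\in\mathbb R^{q\times q},$$ which is a real symmetric matrix, and let $\lambda_2(G_{kk})$ be its second smallest eigenvalue, counted with multiplicity. Suppose $\lambda_2(G_{kk})>0$ for all $k=1,\dots,n$. Then there exists $r>0$ such that for every $\varepsilon\in(0,r)$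 the array $$M\ddot x_i+Kx_i+\sum_{j=1}^q D_{ij}(\dot x_i-\dot x_j)+\varepsilon\sum_{j=1}^q R_{ij}(x_i-x_j)=0,\qquad i=1,\dots,q,$$ synchronizes, i.e. every solution satisfies $\|x_i(t)-x_j(t)\|\to0$ as $t\to\infty$ for all $i,j$. -/

import Mathlib

open scoped MatrixOrder Matrix Kronecker

/-- The weights of a matrix-weighted Laplacian: `W i j` is symmetric positive semidefinite,
`W i j = W j i`, and `W i i = 0`. -/
structure IsWeight {q n : ℕ} (W : Fin q → Fin q → Matrix (Fin n) (Fin n) ℝ) : Prop where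
  posSemidef : ∀ i j, (W i j).PosSemidef
  symm : ∀ i j, W i j = W j i
  diag : ∀ i, W i i = 0

/-- The matrix-weighted Laplacian `lap (W i j)`, a `q × q` block matrix with `n × n` blocks:
the `i`-th diagonal block is `∑ j, W i j`, and the off-diagonal block `(i, j)` is `- W i j`. -/
def lap {q n : ℕ} (W : Fin q → Fin q → Matrix (Fin n) (Fin n) ℝ) :
    Matrix (Fin q × Fin n) (Fin q × Fin n) ℝ :=
  Matrix.of fun x y =>
    if x.1 = y.1 then (∑ l, W x.1 l) x.2 y.2 else -(W x.1 y.1 x.2 y.2)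

/-- `x` (with `x i` the trajectory of the `i`-th oscillator) is a solution of
`M xᵢ'' + K xᵢ + ∑ⱼ Dᵢⱼ (xᵢ' - xⱼ') + ∑ⱼ Rᵢⱼ (xᵢ - xⱼ) = 0`, `i = 1, …, q`. -/
def IsArraySolution {q n : ℕ} (M K : Matrix (Fin n) (Fin n) ℝ)
    (D R : Fin q → Fin q → Matrix (Fin n) (Fin n) ℝ)
    (x : Fin q → ℝ → EuclideanSpace ℝ (Fin n)) : Prop :=
  ∃ x' x'' : Fin q → ℝ → EuclideanSpace ℝ (Fin n),
    (∀ i t, HasDerivAt (x i) (x' i t) t) ∧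
    (∀ i t, HasDerivAt (x' i) (x'' i t) t) ∧
    ∀ i t, M *ᵥ (x'' i t).ofLp + K *ᵥ (x i t).ofLp
        + ∑ j, D i j *ᵥ (x' i t - x' j t).ofLp
        + ∑ j, R i j *ᵥ (x i t - x j t).ofLp = 0

/-- The array synchronizes: along every solution, `‖xᵢ(t) - xⱼ(t)‖ → 0` as `t → ∞` for all
`i, j`. -/
def Synchronizes {q n : ℕ} (M K : Matrix (Fin n) (Fin n) ℝ)
    (D R : Fin q → Fin q → Matrix (Fin n) (Fin n) ℝ) : Prop :=
  ∀ x : Fin q → ℝ → EuclideanSpace ℝ (Fin n), IsArraySolution M K D R x →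
    ∀ i j, Filter.Tendsto (fun t => ‖x i t - x j t‖) Filter.atTop (nhds 0)

/-- `M ^ (-1/2)`, the inverse of the positive semidefinite square root of `M`. -/
noncomputable def invSqrt {n : ℕ} (M : Matrix (Fin n) (Fin n) ℝ) : Matrix (Fin n) (Fin n) ℝ :=
  (CFC.sqrt M)⁻¹

/-- `P = M ^ (-1/2) * K * M ^ (-1/2)`. -/
noncomputable def normalized {n : ℕ} (M K : Matrix (Fin n) (Fin n) ℝ) :
    Matrix (Fin n) (Fin n) ℝ :=
  invSqrt M * K * invSqrt M

/-- The dissipative Laplacian `L_d = lap (M ^ (-1/2) * D i j * M ^ (-1/2))`. -/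
noncomputable def dissLap {q n : ℕ} (M : Matrix (Fin n) (Fin n) ℝ)
    (D : Fin q → Fin q → Matrix (Fin n) (Fin n) ℝ) :
    Matrix (Fin q × Fin n) (Fin q × Fin n) ℝ :=
  lap fun i j => invSqrt M * D i j * invSqrt M

/-- The `qn × q` matrix `I_q ⊗ v` for a column vector `v` of length `n`. -/
def idKron (q : ℕ) {n : ℕ} (v : Fin n → ℝ) : Matrix (Fin q × Fin n) (Fin q) ℝ :=
  ((1 : Matrix (Fin q) (Fin q) ℝ) ⊗ₖ Matrix.replicateCol Unit v).submatrix id fun i => (i, ())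

/-- The projection `[I_q ⊗ vᵀ] L [I_q ⊗ v]` of `L` along `v`. -/
def projLap {q n : ℕ} (L : Matrix (Fin q × Fin n) (Fin q × Fin n) ℝ) (v : Fin n → ℝ) :
    Matrix (Fin q) (Fin q) ℝ :=
  (idKron q v)ᵀ * L * idKron q v

theorem length_sort_re_roots_charpoly {m : ℕ} (X : Matrix (Fin m) (Fin m) ℂ) :
    ((X.charpoly.roots.map Complex.re).sort (· ≤ ·)).length = m := by
  rw [Multiset.length_sort, Multiset.card_map,
    ← (IsAlgClosed.splits X.charpoly).natDegree_eq_card_roots, X.charpoly_natDegree_eq_dim,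
    Fintype.card_fin]

/-- `eigRe X 0 ≤ eigRe X 1 ≤ ⋯ ≤ eigRe X (m - 1)` are the real parts of the `m` eigenvalues of
`X`, listed in increasing order and repeated according to algebraic multiplicity. So `eigRe X k`
is the real part of the `(k+1)`-st smallest eigenvalue `λ_{k+1}(X)` with respect to the real
part; it is the eigenvalue itself when `X` is a real symmetric matrix. -/
noncomputable def eigRe {m : ℕ} (X : Matrix (Fin m) (Fin m) ℂ) (k : Fin m) : ℝ :=
  ((X.charpoly.roots.map Complex.re).sort (· ≤ ·)).get
    (k.cast (length_sort_re_roots_charpoly X).symm)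

/-! Put `z i = M^(1/2) x i` and let `y` collect the deviations of the `z i` from their mean. Since
`y` has zero sum, `y'' + C y' + A y = 0` with `A = I ⊗ P + ε L_r` and `C = L_d + S`, where `S`
(`sumOp`) replaces every component by the total. `S` vanishes along `y'`; it is added only to remove
the consensus directions from `ker C`, so that `y → 0` can be proved on the whole space rather than
on the zero-sum subspace.

Here `A` is positive definite and `C` positive semidefinite, so the energy never increases. By a
LaSalle argument it tends to zero once no eigenvector of `A` lies in `ker C` (`dampedEnergy_lt`,
`tendsto_zero_of_damped`). By compactness of the unit sphere this condition survives small changes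
of `A` (`exists_pos_forall_no_eigenvector_in_ker`), so it is enough to check it at `ε = 0`.

There, an eigenvector of `I ⊗ P` has components `u i • v k` with a single `k`, because the `σ k` are
distinct (`exists_eq_smul_of_eigenvectors`). Membership in `ker C` then gives `G_kk u = 0` and `∑ u
i = 0`. As `G_kk` also kills the all-ones vector, `λ₂(G_kk) > 0` forces `u = 0`
(`eq_zero_of_eigRe_one_pos`). -/

/-! ### Second eigenvalue and kernel of a symmetric matrix. -/

/-- A Hermitian matrix with two linearly independent vectors in its kernel has at least two
vanishing eigenvalues. -/
theorem Matrix.IsHermitian.two_le_card_eigenvalues_eq_zero {m : ℕ} {X : Matrix (Fin m) (Fin m) ℂ}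
    (hX : X.IsHermitian) {a b : Fin m → ℂ} (hab : LinearIndependent ℂ ![a, b])
    (ha : X *ᵥ a = 0) (hb : X *ᵥ b = 0) :
    2 ≤ Fintype.card {i // hX.eigenvalues i = 0} := by
  have hker : 2 ≤ Module.finrank ℂ (LinearMap.ker X.mulVecLin) := by
    have hmem : ∀ i, ![a, b] i ∈ LinearMap.ker X.mulVecLin := by
      intro i
      fin_cases i
      · simpa using ha
      · simpa using hb
    have hli : LinearIndependent ℂ
        (fun i => (⟨![a, b] i, hmem i⟩ : LinearMap.ker X.mulVecLin)) :=
      LinearIndependent.of_comp (LinearMap.ker X.mulVecLin).subtype hab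
    simpa using hli.fintype_card_le_finrank
  have hrn := LinearMap.finrank_range_add_finrank_ker X.mulVecLin
  have hrank : Module.finrank ℂ (LinearMap.range X.mulVecLin) = X.rank := rfl
  rw [hrank, hX.rank_eq_card_non_zero_eigs, Module.finrank_fin_fun] at hrn
  have := Fintype.card_subtype_compl (fun i => hX.eigenvalues i = 0)
  have hle := Fintype.card_subtype_le (fun i => hX.eigenvalues i = 0)
  rw [Fintype.card_fin] at this hle
  have h' : Fintype.card {i // hX.eigenvalues i ≠ 0}
    = Fintype.card {i // ¬ hX.eigenvalues i = 0} := rfl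
  omega

/-- If entry 1 of the sorted list were positive, so would be every later entry, leaving only the
head as a possible zero. -/
theorem eigRe_one_nonpos_of_two_le_count {m : ℕ} (hm : 2 ≤ m) {X : Matrix (Fin m) (Fin m) ℂ}
    (h : 2 ≤ (X.charpoly.roots.map Complex.re).count 0) : eigRe X ⟨1, hm⟩ ≤ 0 := by
  by_contra! hpos
  set l := (X.charpoly.roots.map Complex.re).sort (· ≤ ·) with hl
  have hcount : 2 ≤ l.count 0 := by
    rwa [← Multiset.coe_count, hl, Multiset.sort_eq]
  have hsorted : l.Pairwise (· ≤ ·) := Multiset.pairwise_sort _ _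
  have hget : ∀ (x y : ℝ) (l' : List ℝ) (k : Fin (x :: y :: l').length), k.1 = 1 →
      (x :: y :: l').get k = y := by
    rintro x y l' ⟨k, hk⟩ rfl
    rfl
  have hpos' : ∀ (k : Fin l.length), k.1 = 1 → 0 < l.get k := by
    rintro k hk
    have hk' : k = (⟨1, hm⟩ : Fin m).cast (length_sort_re_roots_charpoly X).symm := Fin.ext hk
    rw [hk']
    exact hpos
  have hlen : l.length = m := length_sort_re_roots_charpoly X
  clear_value l
  match l, hcount, hsorted, hpos', hlen with
  | [], hc, _, _, _ => simp at hc
  | [x], hc, _, _, _ => exact absurd (hc.trans (List.count_le_length)) (by simp)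
  | x :: y :: l', hc, hs, hp, _ =>
    have hy : 0 < y := hp ⟨1, by simp⟩ rfl
    have h0 : (y :: l').count 0 = 0 := by
      refine List.count_eq_zero.2 fun hmem => ?_
      rcases List.mem_cons.1 hmem with h0 | h0
      · exact hy.ne h0
      · exact absurd (List.rel_of_pairwise_cons hs.of_cons h0) hy.not_ge
    have := List.count_cons (a := (0 : ℝ)) (b := x) (l := y :: l')
    rw [h0] at this
    split_ifs at this <;> omega

/-- A real symmetric matrix that annihilates the all-ones vector and has a positive second
eigenvalue annihilates no other vector with vanishing sum. -/
theorem eq_zero_of_eigRe_one_pos {m : ℕ} (hm : 2 ≤ m) {G : Matrix (Fin m) (Fin m) ℝ}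
    (hG : G.IsHermitian) (hpos : 0 < eigRe (G.map Complex.ofReal) ⟨1, hm⟩)
    (hone : G *ᵥ (fun _ => 1) = 0) {u : Fin m → ℝ} (hu : G *ᵥ u = 0) (hsum : ∑ i, u i = 0) :
    u = 0 := by
  by_contra hne
  set X := G.map Complex.ofReal with hXdef
  have hX : X.IsHermitian := hG.map _ fun x => by simp
  have hmul : ∀ w : Fin m → ℝ, G *ᵥ w = 0 → X *ᵥ (fun i => (w i : ℂ)) = 0 := fun w hw => by
    ext i
    have := congrArg Complex.ofReal (congrFun hw i)
    simpa [Matrix.mulVec, dotProduct, hXdef] using this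
  -- Summing the entries of `s • 1 + t • u = 0` gives `m * s = 0`, because `u` has zero sum.
  have hab : LinearIndependent ℂ ![fun i : Fin m => (((fun _ => 1 : Fin m → ℝ) i : ℝ) : ℂ),
      fun i => (u i : ℂ)] := by
    rw [LinearIndependent.pair_iff]
    intro s t hst
    have hst' : ∀ i, s + t * (u i : ℂ) = 0 := fun i => by simpa using congrFun hst i
    have hs : s = 0 := by
      have h1 : ∑ i, (s + t * (u i : ℂ)) = 0 := Finset.sum_eq_zero fun i _ => hst' i
      have h2 : (∑ i, (u i : ℂ)) = 0 := by exact_mod_cast congrArg Complex.ofReal hsum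
      rw [Finset.sum_add_distrib, ← Finset.mul_sum, h2] at h1
      have : (m : ℂ) ≠ 0 := Nat.cast_ne_zero.2 (by omega)
      simpa [this] using h1
    refine ⟨hs, ?_⟩
    obtain ⟨i, hi⟩ := Function.ne_iff.1 hne
    have := hst' i
    rw [hs, zero_add, mul_eq_zero] at this
    exact this.resolve_right (by exact_mod_cast hi)
  have hcard := hX.two_le_card_eigenvalues_eq_zero hab (hmul _ hone) (hmul _ hu)
  refine absurd (eigRe_one_nonpos_of_two_le_count hm ?_) (not_le.2 hpos)
  rw [hX.roots_charpoly_eq_eigenvalues, Multiset.map_map, Multiset.count_map]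
  rw [Fintype.card_subtype] at hcard
  convert hcard using 1
  rw [Finset.card_def, Finset.filter_val]
  congr 1
  refine Multiset.filter_congr fun i _ => ?_
  simp [eq_comm]

/-! ### Damped second-order systems: decay and its robustness. -/

open scoped InnerProductSpace Topology
open Filter

section Damped

variable {V : Type*} [NormedAddCommGroup V] [InnerProductSpace ℝ V]

/-- Along `x + t • C x` the form equals `2 t a + t² b` with `a = ‖C x‖²`, which is negative for
small `t < 0` unless `a = 0`. -/
theorem eq_zero_of_inner_map_self_eq_zero {C : V →L[ℝ] V}
    (hC : (C : V →ₗ[ℝ] V).IsSymmetric) (hpos : ∀ x, 0 ≤ ⟪C x, x⟫_ℝ) {x : V}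
    (hx : ⟪C x, x⟫_ℝ = 0) : C x = 0 := by
  by_contra hne
  have ha : 0 < ⟪C x, C x⟫_ℝ := real_inner_self_pos.2 hne
  set a := ⟪C x, C x⟫_ℝ with ha'
  set b := ⟪C (C x), C x⟫_ℝ with hb'
  have hb : 0 ≤ b := hpos _
  have hsym : ⟪C (C x), x⟫_ℝ = a := hC (C x) x
  have key : ∀ t : ℝ, 0 ≤ 2 * t * a + t ^ 2 * b := fun t => by
    have h := hpos (x + t • C x)
    simp only [map_add, map_smul, inner_add_left, inner_add_right, inner_smul_left,
      inner_smul_right, hx, hsym, ← ha', ← hb'] at h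
    simp only [conj_trivial] at h
    linarith
  -- Near the minimiser `-a / b`; the shift by 1 covers `b = 0`.
  have h := key (-(a / (b + 1)))
  have hb1 : 0 < b + 1 := by linarith
  have : 2 * -(a / (b + 1)) * a + (-(a / (b + 1))) ^ 2 * b
      = -(a ^ 2 * (b + 2)) / (b + 1) ^ 2 := by
    field_simp
    ring
  rw [this] at h
  have : -(a ^ 2 * (b + 2)) / (b + 1) ^ 2 < 0 :=
    div_neg_of_neg_of_pos (neg_lt_zero.2 (by positivity)) (by positivity)
  linarith

/-- If no eigenvector of the symmetric operator `A` lies in `ker C`, then the pair `(C, A)` is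
observable. -/
theorem eq_zero_of_forall_map_pow_eq_zero [FiniteDimensional ℝ V] {A C : V →L[ℝ] V}
    (hA : (A : V →ₗ[ℝ] V).IsSymmetric)
    (hobs : ∀ (μ : ℝ) (w : V), A w = μ • w → C w = 0 → w = 0) {w : V}
    (hw : ∀ k : ℕ, C ((A ^ k) w) = 0) : w = 0 := by
  -- The unobservable subspace is `A`-invariant and contained in `ker C`; if nonzero, it contains an
  -- eigenvector of the symmetric operator `A`.
  let U : Submodule ℝ V := ⨅ k : ℕ, LinearMap.ker ((C ∘L A ^ k : V →L[ℝ] V) : V →ₗ[ℝ] V)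
  have hU : ∀ x, x ∈ U ↔ ∀ k : ℕ, C ((A ^ k) x) = 0 := fun x => by
    simp only [U, Submodule.mem_iInf]
    rfl
  have hinv : ∀ x ∈ U, (A : V →ₗ[ℝ] V) x ∈ U := fun x hx => by
    rw [hU] at hx ⊢
    intro k
    have := hx (k + 1)
    rwa [pow_succ] at this
  by_contra hne
  have hwU : w ∈ U := (hU w).2 hw
  have : Nontrivial U := ⟨⟨⟨w, hwU⟩, 0, fun h => hne (congrArg Subtype.val h)⟩⟩
  obtain ⟨u, hu⟩ :=
    (hA.restrict_invariant hinv).hasEigenvalue_iSup_of_finiteDimensional.exists_hasEigenvector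
  have h0 := hobs _ (u : V) (by simpa using congrArg Subtype.val hu.apply_eq_smul)
    (by simpa using (hU _).1 u.2 0)
  exact hu.2 (Subtype.ext h0)

/-- The vector field of `y'' + C y' + A y = 0` as a first-order system. -/
noncomputable def dampedField (A C : V →L[ℝ] V) : (V × V) →L[ℝ] (V × V) :=
  (ContinuousLinearMap.snd ℝ V V).prod
    (-(C ∘L ContinuousLinearMap.snd ℝ V V) - A ∘L ContinuousLinearMap.fst ℝ V V)

/-- Twice the energy of a state of `y'' + C y' + A y = 0`. -/
noncomputable def dampedEnergy (A : V →L[ℝ] V) (X : V × V) : ℝ :=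
  ⟪X.2, X.2⟫_ℝ + ⟪A X.1, X.1⟫_ℝ

theorem continuous_dampedEnergy (A : V →L[ℝ] V) : Continuous (dampedEnergy A) := by
  unfold dampedEnergy
  fun_prop

theorem dampedEnergy_smul (A : V →L[ℝ] V) (c : ℝ) (X : V × V) :
    dampedEnergy A (c • X) = c ^ 2 * dampedEnergy A X := by
  simp only [dampedEnergy, Prod.smul_fst, Prod.smul_snd, map_smul, inner_smul_left,
    inner_smul_right, conj_trivial]
  ring

theorem dampedEnergy_pos {A : V →L[ℝ] V} (hA : ∀ x, x ≠ 0 → 0 < ⟪A x, x⟫_ℝ) {X : V × V}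
    (hX : X ≠ 0) : 0 < dampedEnergy A X := by
  have h1 : 0 ≤ ⟪A X.1, X.1⟫_ℝ := by
    by_cases h : X.1 = 0
    · simp [h]
    · exact (hA _ h).le
  by_cases h : X.1 = 0
  · have h2 : X.2 ≠ 0 := fun h2 => hX (Prod.ext h h2)
    exact add_pos_of_pos_of_nonneg (real_inner_self_pos.2 h2) h1
  · exact add_pos_of_nonneg_of_pos real_inner_self_nonneg (hA _ h)

theorem hasDerivAt_dampedEnergy {A C : V →L[ℝ] V} (hA : (A : V →ₗ[ℝ] V).IsSymmetric)
    {X : ℝ → V × V} {t : ℝ} (hX : HasDerivAt X (dampedField A C (X t)) t) :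
    HasDerivAt (fun s => dampedEnergy A (X s)) (-2 * ⟪C (X t).2, (X t).2⟫_ℝ) t := by
  have h1 : HasDerivAt (fun s => (X s).1) (X t).2 t := hX.fst
  have h2 : HasDerivAt (fun s => (X s).2) (-C (X t).2 - A (X t).1) t := hX.snd
  have h3 : HasDerivAt (fun s => A (X s).1) (A (X t).2) t :=
    A.hasFDerivAt.comp_hasDerivAt t h1
  refine ((h2.inner ℝ h2).add (h3.inner ℝ h1)).congr_deriv ?_
  have hs : ⟪A (X t).2, (X t).1⟫_ℝ = ⟪(X t).2, A (X t).1⟫_ℝ := hA _ _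
  simp only [inner_sub_left, inner_sub_right, inner_neg_left, inner_neg_right, hs]
  rw [real_inner_comm (A (X t).1) (X t).2, real_inner_comm (C (X t).2) (X t).2]
  ring

theorem antitone_dampedEnergy {A C : V →L[ℝ] V} (hA : (A : V →ₗ[ℝ] V).IsSymmetric)
    (hpos : ∀ x, 0 ≤ ⟪C x, x⟫_ℝ) {X : ℝ → V × V}
    (hX : ∀ t, HasDerivAt X (dampedField A C (X t)) t) :
    Antitone fun s => dampedEnergy A (X s) :=
  antitone_of_hasDerivAt_nonpos (fun t => hasDerivAt_dampedEnergy hA (hX t)) fun t => by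
    have := hpos (X t).2
    simp only [Pi.zero_apply]
    linarith

/-- The energy of a nontrivial solution strictly decreases over a unit of time. -/
theorem dampedEnergy_lt [FiniteDimensional ℝ V] {A C : V →L[ℝ] V}
    (hA : (A : V →ₗ[ℝ] V).IsSymmetric) (hApos : ∀ x, x ≠ 0 → 0 < ⟪A x, x⟫_ℝ)
    (hC : (C : V →ₗ[ℝ] V).IsSymmetric) (hpos : ∀ x, 0 ≤ ⟪C x, x⟫_ℝ)
    (hobs : ∀ (μ : ℝ) (w : V), A w = μ • w → C w = 0 → w = 0) {X : ℝ → V × V}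
    (hX : ∀ t, HasDerivAt X (dampedField A C (X t)) t) (h0 : X 0 ≠ 0) :
    dampedEnergy A (X 1) < dampedEnergy A (X 0) := by
  have hanti := antitone_dampedEnergy hA hpos hX
  refine lt_of_le_of_ne (hanti zero_le_one) fun heq => h0 ?_
  have hconst : ∀ t ∈ Set.Ioo (0 : ℝ) 1, dampedEnergy A (X t) = dampedEnergy A (X 0) :=
    fun t ht => le_antisymm (hanti ht.1.le) (heq ▸ hanti ht.2.le)
  have hconv : ∀ {f : ℝ → V} {f' : ℝ → V}, (∀ t, HasDerivAt f (f' t) t) →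
      (∀ t ∈ Set.Ioo (0 : ℝ) 1, f t = 0) → ∀ t ∈ Set.Ioo (0 : ℝ) 1, f' t = 0 := by
    intro f f' hf h t ht
    refine (hf t).unique ((hasDerivAt_const t (0 : V)).congr_of_eventuallyEq ?_)
    filter_upwards [isOpen_Ioo.mem_nhds ht] with s hs using h s hs
  have hCv : ∀ t ∈ Set.Ioo (0 : ℝ) 1, C (X t).2 = 0 := fun t ht => by
    refine eq_zero_of_inner_map_self_eq_zero hC hpos ?_
    have h1 : HasDerivAt (fun s => dampedEnergy A (X s)) 0 t := by
      refine (hasDerivAt_const t (dampedEnergy A (X 0))).congr_of_eventuallyEq ?_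
      filter_upwards [isOpen_Ioo.mem_nhds ht] with s hs using hconst s hs
    have := (hasDerivAt_dampedEnergy hA (hX t)).unique h1
    linarith
  have hX1 : ∀ t, HasDerivAt (fun s => (X s).1) (X t).2 t := fun t => (hX t).fst
  have hX2 : ∀ t, HasDerivAt (fun s => (X s).2) (-C (X t).2 - A (X t).1) t :=
    fun t => (hX t).snd
  -- Differentiating `C A^k y' = 0` and using `C y' = 0` gives `C A^(k+1) y = 0`; differentiating
  -- once more gives the next case.
  have hCA : ∀ k : ℕ, ∀ t ∈ Set.Ioo (0 : ℝ) 1, C ((A ^ k) (X t).2) = 0 := by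
    intro k
    induction k with
    | zero => simpa using hCv
    | succ k ih =>
      have h1 := hconv (f := fun t => C ((A ^ k) (X t).2))
        (f' := fun t => C ((A ^ k) (-C (X t).2 - A (X t).1)))
        (fun t => (C ∘L A ^ k).hasFDerivAt.comp_hasDerivAt t (hX2 t)) ih
      have h2 : ∀ t ∈ Set.Ioo (0 : ℝ) 1, C ((A ^ (k + 1)) (X t).1) = 0 := fun t ht => by
        have := h1 t ht
        simpa [hCv t ht, pow_succ] using this
      exact hconv (f' := fun t => C ((A ^ (k + 1)) (X t).2))
        (fun t => (C ∘L A ^ (k + 1)).hasFDerivAt.comp_hasDerivAt t (hX1 t)) h2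
  have hv : ∀ t ∈ Set.Ioo (0 : ℝ) 1, (X t).2 = 0 := fun t ht =>
    eq_zero_of_forall_map_pow_eq_zero hA hobs fun k => hCA k t ht
  have hy : ∀ t ∈ Set.Ioo (0 : ℝ) 1, (X t).1 = 0 := fun t ht => by
    have h1 := hconv hX2 hv t ht
    rw [hCv t ht, neg_zero, zero_sub, neg_eq_zero] at h1
    by_contra hne
    have := hApos _ hne
    rw [h1, inner_zero_left] at this
    exact this.false
  have hmem : (1 / 2 : ℝ) ∈ Set.Ioo (0 : ℝ) 1 := by norm_num
  have hE := hconst _ hmem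
  by_contra hne
  have := dampedEnergy_pos hApos hne
  rw [← hE, dampedEnergy, hy _ hmem, hv _ hmem] at this
  simp at this

theorem exists_linear_flow {W : Type*} [NormedAddCommGroup W] [NormedSpace ℝ W]
    [CompleteSpace W] (B : W →L[ℝ] W) : ∃ Φ : ℝ → W →L[ℝ] W,
      (∀ x, Φ 0 x = x) ∧ ∀ x t, HasDerivAt (fun s => Φ s x) (B (Φ t x)) t :=
  ⟨fun t => NormedSpace.exp (t • B), fun x => by simp, fun x t =>
    (ContinuousLinearMap.apply ℝ W x).hasFDerivAt.comp_hasDerivAt t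
      (hasDerivAt_exp_smul_const' (𝕂 := ℝ) B t)⟩

/-- The energy is quadratic and the time-one map linear, so their ratio attains its maximum `c` on
the unit sphere, and strict decrease there gives `c < 1`. Energy thus decays geometrically at
integer times, and monotonicity covers the times between. -/
theorem tendsto_zero_of_damped [FiniteDimensional ℝ V] {A C : V →L[ℝ] V}
    (hA : (A : V →ₗ[ℝ] V).IsSymmetric) (hApos : ∀ x, x ≠ 0 → 0 < ⟪A x, x⟫_ℝ)
    (hC : (C : V →ₗ[ℝ] V).IsSymmetric) (hpos : ∀ x, 0 ≤ ⟪C x, x⟫_ℝ)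
    (hobs : ∀ (μ : ℝ) (w : V), A w = μ • w → C w = 0 → w = 0) {y y' y'' : ℝ → V}
    (hy : ∀ t, HasDerivAt y (y' t) t) (hy' : ∀ t, HasDerivAt y' (y'' t) t)
    (heq : ∀ t, y'' t + C (y' t) + A (y t) = 0) : Tendsto y atTop (𝓝 0) := by
  set B := dampedField A C with hB
  let X : ℝ → V × V := fun t => (y t, y' t)
  have hX : ∀ t, HasDerivAt X (B (X t)) t := fun t => by
    refine ((hy t).prodMk (hy' t)).congr_deriv ?_
    have : y'' t = -C (y' t) - A (y t) := by
      rw [← sub_eq_zero, ← heq t]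
      abel
    rw [this]
    rfl
  obtain ⟨Φ, hΦ0, hΦ⟩ := exists_linear_flow B
  have hstep : ∀ s, X (s + 1) = Φ 1 (X s) := fun s => by
    have := ODE_solution_unique_univ (v := fun _ => B) (s := fun _ => Set.univ) (K := ‖B‖₊)
      (f := fun t => X (s + t)) (g := fun t => Φ t (X s)) (t₀ := 0)
      (fun _ => B.lipschitz.lipschitzOnWith)
      (fun t => ⟨(hX (s + t)).comp_const_add s t, trivial⟩)
      (fun t => ⟨hΦ _ t, trivial⟩) (by simp [hΦ0])
    exact congrFun this 1
  set E := dampedEnergy A with hE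
  have hEnonneg : ∀ x, 0 ≤ E x := fun x => by
    by_cases h : x = 0
    · simp [h, hE, dampedEnergy]
    · exact (dampedEnergy_pos hApos h).le
  rcases subsingleton_or_nontrivial V with hV | hV
  · exact tendsto_const_nhds.congr fun t => Subsingleton.elim _ _
  have hne : (Metric.sphere (0 : V × V) 1).Nonempty := NormedSpace.sphere_nonempty.2 zero_le_one
  have hcpt : IsCompact (Metric.sphere (0 : V × V) 1) := isCompact_sphere _ _
  have hsph : ∀ x ∈ Metric.sphere (0 : V × V) 1, x ≠ 0 := fun x hx =>
    ne_zero_of_mem_unit_sphere ⟨x, hx⟩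
  have hEc : Continuous E := continuous_dampedEnergy A
  have hΦc : Continuous (Φ 1) := (Φ 1).continuous
  obtain ⟨x₁, hx₁, hmax⟩ := hcpt.exists_isMaxOn hne
    (f := fun x => E (Φ 1 x) / E x)
    ((hEc.comp hΦc).continuousOn.div hEc.continuousOn
      fun x hx => (dampedEnergy_pos hApos (hsph x hx)).ne')
  obtain ⟨x₀, hx₀, hmin⟩ := hcpt.exists_isMinOn hne hEc.continuousOn
  set c := E (Φ 1 x₁) / E x₁ with hc
  have hc0 : 0 ≤ c := div_nonneg (hEnonneg _) (hEnonneg _)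
  have hc1 : c < 1 := by
    rw [hc, div_lt_one (dampedEnergy_pos hApos (hsph _ hx₁))]
    have := dampedEnergy_lt hA hApos hC hpos hobs (X := fun t => Φ t x₁) (hΦ x₁)
      (by simpa [hΦ0] using hsph _ hx₁)
    simpa [hΦ0] using this
  have hm : 0 < E x₀ := dampedEnergy_pos hApos (hsph _ hx₀)
  have hnorm : ∀ x : V × V, x ≠ 0 → ∃ u ∈ Metric.sphere (0 : V × V) 1, x = ‖x‖ • u :=
    fun x hx => by
      have hx' : ‖x‖ ≠ 0 := norm_ne_zero_iff.2 hx
      exact ⟨‖x‖⁻¹ • x, by simp [norm_smul, hx'], by rw [smul_smul, mul_inv_cancel₀ hx', one_smul]⟩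
  have hcontr : ∀ x, E (Φ 1 x) ≤ c * E x := fun x => by
    by_cases hx : x = 0
    · simp [hx, hE, dampedEnergy]
    obtain ⟨u, hu, hxu⟩ := hnorm x hx
    have h1 : E (Φ 1 u) / E u ≤ c := hmax hu
    rw [div_le_iff₀ (dampedEnergy_pos hApos (hsph _ hu))] at h1
    have h2 : Φ 1 x = ‖x‖ • Φ 1 u := by
      conv_lhs => rw [hxu]
      rw [map_smul]
    have h3 : E x = ‖x‖ ^ 2 * E u := by
      conv_lhs => rw [hxu]
      exact dampedEnergy_smul A _ _
    rw [h2, h3, hE, dampedEnergy_smul, ← hE, mul_left_comm]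
    exact mul_le_mul_of_nonneg_left h1 (sq_nonneg _)
  have hlow : ∀ x, E x₀ * ‖x‖ ^ 2 ≤ E x := fun x => by
    by_cases hx : x = 0
    · simp [hx, hE, dampedEnergy]
    obtain ⟨u, hu, hxu⟩ := hnorm x hx
    have h1 : E x₀ ≤ E u := hmin hu
    have h3 : E x = ‖x‖ ^ 2 * E u := by
      conv_lhs => rw [hxu]
      exact dampedEnergy_smul A _ _
    rw [h3, mul_comm]
    exact mul_le_mul_of_nonneg_left h1 (sq_nonneg _)
  have hpow : ∀ k : ℕ, E (X k) ≤ c ^ k * E (X 0) := fun k => by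
    induction k with
    | zero => simp
    | succ k ih =>
      push_cast
      rw [hstep, pow_succ', mul_assoc]
      exact (hcontr _).trans (mul_le_mul_of_nonneg_left ih hc0)
  have hanti : Antitone fun t => E (X t) := antitone_dampedEnergy hA hpos hX
  have hE0 : Tendsto (fun t => E (X t)) atTop (𝓝 0) := by
    have h1 : Tendsto (fun t : ℝ => c ^ ⌊t⌋₊ * E (X 0)) atTop (𝓝 0) := by
      simpa using ((tendsto_pow_atTop_nhds_zero_of_lt_one hc0 hc1).comp
        tendsto_nat_floor_atTop).mul_const (E (X 0))
    refine squeeze_zero' (Eventually.of_forall fun t => hEnonneg _) ?_ h1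
    filter_upwards [eventually_ge_atTop 0] with t ht
    exact (hanti (Nat.floor_le ht)).trans (hpow _)
  have hsq : Tendsto (fun t => ‖y t‖ ^ 2) atTop (𝓝 0) := by
    have h1 : Tendsto (fun t => E (X t) / E x₀) atTop (𝓝 0) := by
      simpa using hE0.div_const (E x₀)
    refine squeeze_zero (fun t => sq_nonneg _) (fun t => ?_) h1
    rw [le_div_iff₀ hm, mul_comm]
    refine le_trans (mul_le_mul_of_nonneg_left ?_ hm.le) (hlow _)
    gcongr
    exact norm_fst_le (X t)
  rw [tendsto_zero_iff_norm_tendsto_zero]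
  simpa [Real.sqrt_sq (norm_nonneg _)] using hsq.sqrt

/-- Having no eigenvector in `ker C` is stable under small perturbations. -/
theorem exists_pos_forall_no_eigenvector_in_ker [FiniteDimensional ℝ V] (A A' C : V →L[ℝ] V)
    (hobs : ∀ (μ : ℝ) (w : V), A w = μ • w → C w = 0 → w = 0) :
    ∃ r : ℝ, 0 < r ∧ ∀ ε : ℝ, 0 < ε → ε < r →
      ∀ (μ : ℝ) (w : V), (A + ε • A') w = μ • w → C w = 0 → w = 0 := by
  -- For unit `w` this vanishes exactly when `w` is an eigenvector of `A + ε • A'` in `ker C`. The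
  -- Rayleigh quotient replaces `μ`, so only the compact sphere has to be searched.
  let F : ℝ → V → ℝ := fun ε w =>
    ‖(A w + ε • A' w) - ⟪A w + ε • A' w, w⟫_ℝ • w‖ + ‖C w‖
  have hF : Continuous fun p : ℝ × V => F p.1 p.2 := by
    unfold F
    fun_prop
  have hsph : ∀ x ∈ Metric.sphere (0 : V) 1, x ≠ 0 := fun x hx =>
    ne_zero_of_mem_unit_sphere ⟨x, hx⟩
  have hev : ∀ᶠ ε in 𝓝 (0 : ℝ), ∀ w ∈ Metric.sphere (0 : V) 1, 0 < F ε w := by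
    refine (isCompact_sphere (0 : V) 1).eventually_forall_of_forall_eventually fun w hw => ?_
    refine hF.continuousAt.eventually_const_lt ?_
    refine lt_of_le_of_ne (by positivity) fun h => hsph w hw ?_
    have h' := (add_eq_zero_iff_of_nonneg (norm_nonneg _) (norm_nonneg _)).1 h.symm
    simp only [norm_eq_zero, zero_smul, add_zero, sub_eq_zero] at h'
    exact hobs _ w h'.1 h'.2
  obtain ⟨r, hr, hball⟩ := Metric.eventually_nhds_iff.1 hev
  refine ⟨r, hr, fun ε hε hεr μ w hw hCw => ?_⟩
  by_contra hne
  have hn : ‖w‖ ≠ 0 := norm_ne_zero_iff.2 hne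
  set u := ‖w‖⁻¹ • w with hu
  have hu1 : ‖u‖ = 1 := by simp [hu, norm_smul, hn]
  have hAu : A u + ε • A' u = μ • u := by
    have : (A + ε • A') u = μ • u := by rw [hu, map_smul, hw, smul_comm]
    simpa using this
  have hCu : C u = 0 := by rw [hu, map_smul, hCw, smul_zero]
  have := hball (y := ε) (by simpa [abs_of_pos hε] using hεr) u (by simpa using hu1)
  simp [F, hAu, hCu, inner_smul_left, hu1] at this

end Damped

/-! ### Coupled arrays and reduction to deviations from the mean. -/

section Array

variable {ι E : Type*} [Fintype ι] [NormedAddCommGroup E] [InnerProductSpace ℝ E]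

/-- The operator acting by `P` on each component. -/
noncomputable def diagOp (ι : Type*) [Fintype ι] (P : E →L[ℝ] E) :
    PiLp 2 (fun _ : ι => E) →L[ℝ] PiLp 2 (fun _ : ι => E) :=
  (PiLp.continuousLinearEquiv 2 ℝ fun _ : ι => E).symm ∘L
    ContinuousLinearMap.pi fun i => P ∘L (PiLp.proj 2 (fun _ : ι => E) i : _ →L[ℝ] E)

/-- The operator-weighted Laplacian. -/
noncomputable def lapOp (T : ι → ι → E →L[ℝ] E) :
    PiLp 2 (fun _ : ι => E) →L[ℝ] PiLp 2 (fun _ : ι => E) :=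
  (PiLp.continuousLinearEquiv 2 ℝ fun _ : ι => E).symm ∘L
    ContinuousLinearMap.pi fun i => ∑ j, T i j ∘L
      ((PiLp.proj 2 (fun _ : ι => E) i : _ →L[ℝ] E) - (PiLp.proj 2 (fun _ : ι => E) j : _ →L[ℝ] E))

/-- The operator replacing every component by the sum of all components. -/
noncomputable def sumOp (ι E : Type*) [Fintype ι] [NormedAddCommGroup E]
    [InnerProductSpace ℝ E] : PiLp 2 (fun _ : ι => E) →L[ℝ] PiLp 2 (fun _ : ι => E) :=
  (PiLp.continuousLinearEquiv 2 ℝ fun _ : ι => E).symm ∘L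
    ContinuousLinearMap.pi fun _ : ι => ∑ j, (PiLp.proj 2 (fun _ : ι => E) j : _ →L[ℝ] E)

@[simp]
theorem diagOp_apply (P : E →L[ℝ] E) (w : PiLp 2 fun _ : ι => E) (i : ι) :
    diagOp ι P w i = P (w i) := rfl

@[simp]
theorem lapOp_apply (T : ι → ι → E →L[ℝ] E) (w : PiLp 2 fun _ : ι => E) (i : ι) :
    lapOp T w i = ∑ j, T i j (w i - w j) := by
  simp [lapOp]

@[simp]
theorem sumOp_apply (w : PiLp 2 fun _ : ι => E) (i : ι) : sumOp ι E w i = ∑ j, w j := by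
  simp [sumOp]

theorem isSymmetric_diagOp {P : E →L[ℝ] E} (hP : (P : E →ₗ[ℝ] E).IsSymmetric) :
    (diagOp ι P : PiLp 2 (fun _ : ι => E) →ₗ[ℝ] PiLp 2 (fun _ : ι => E)).IsSymmetric :=
  fun w w' => by
    simp only [ContinuousLinearMap.coe_coe, PiLp.inner_apply, diagOp_apply]
    exact Finset.sum_congr rfl fun i _ => hP _ _

theorem inner_diagOp_self_pos {P : E →L[ℝ] E} (hP : ∀ x, x ≠ 0 → 0 < ⟪P x, x⟫_ℝ)
    {w : PiLp 2 fun _ : ι => E} (hw : w ≠ 0) : 0 < ⟪diagOp ι P w, w⟫_ℝ := by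
  have hnn : ∀ x, 0 ≤ ⟪P x, x⟫_ℝ := fun x => by
    by_cases hx : x = 0
    · simp [hx]
    · exact (hP x hx).le
  obtain ⟨i, hi⟩ : ∃ i, w i ≠ 0 := by
    by_contra! h
    exact hw (PiLp.ext h)
  simp only [PiLp.inner_apply, diagOp_apply]
  exact Finset.sum_pos' (fun j _ => hnn _) ⟨i, Finset.mem_univ _, hP _ hi⟩

/-- Exchanging `i` and `j` gives two expressions for the same inner product; adding them produces
the differences of `w'` and the factor 2. -/
theorem two_mul_inner_lapOp {T : ι → ι → E →L[ℝ] E} (hT : ∀ i j, T i j = T j i)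
    (w w' : PiLp 2 fun _ : ι => E) :
    2 * ⟪lapOp T w, w'⟫_ℝ = ∑ i, ∑ j, ⟪T i j (w i - w j), w' i - w' j⟫_ℝ := by
  have h1 : ⟪lapOp T w, w'⟫_ℝ = ∑ i, ∑ j, ⟪T i j (w i - w j), w' i⟫_ℝ := by
    simp only [PiLp.inner_apply, lapOp_apply, sum_inner]
  have h2 : ⟪lapOp T w, w'⟫_ℝ = -∑ i, ∑ j, ⟪T i j (w i - w j), w' j⟫_ℝ := by
    rw [h1, Finset.sum_comm, ← Finset.sum_neg_distrib]
    refine Finset.sum_congr rfl fun i _ => ?_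
    rw [← Finset.sum_neg_distrib]
    refine Finset.sum_congr rfl fun j _ => ?_
    rw [hT j i, ← inner_neg_left, ← map_neg, neg_sub]
  simp only [inner_sub_right, Finset.sum_sub_distrib]
  linarith

theorem isSymmetric_lapOp {T : ι → ι → E →L[ℝ] E} (hT : ∀ i j, T i j = T j i)
    (hTs : ∀ i j, (T i j : E →ₗ[ℝ] E).IsSymmetric) :
    (lapOp T : PiLp 2 (fun _ : ι => E) →ₗ[ℝ] PiLp 2 (fun _ : ι => E)).IsSymmetric :=
  fun w w' => by
    simp only [ContinuousLinearMap.coe_coe]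
    rw [real_inner_comm (lapOp T w') w]
    refine mul_left_cancel₀ (two_ne_zero (α := ℝ)) ?_
    rw [two_mul_inner_lapOp hT, two_mul_inner_lapOp hT]
    refine Finset.sum_congr rfl fun i _ => Finset.sum_congr rfl fun j _ => ?_
    rw [real_inner_comm]
    exact (hTs i j _ _).symm

theorem inner_lapOp_self_nonneg {T : ι → ι → E →L[ℝ] E} (hT : ∀ i j, T i j = T j i)
    (hTpos : ∀ i j x, 0 ≤ ⟪T i j x, x⟫_ℝ) (w : PiLp 2 fun _ : ι => E) :
    0 ≤ ⟪lapOp T w, w⟫_ℝ := by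
  have h := two_mul_inner_lapOp hT w w
  have : 0 ≤ ∑ i, ∑ j, ⟪T i j (w i - w j), w i - w j⟫_ℝ :=
    Finset.sum_nonneg fun i _ => Finset.sum_nonneg fun j _ => hTpos _ _ _
  linarith

theorem inner_sumOp (w w' : PiLp 2 fun _ : ι => E) :
    ⟪sumOp ι E w, w'⟫_ℝ = ⟪∑ i, w i, ∑ i, w' i⟫_ℝ := by
  simp only [PiLp.inner_apply, sumOp_apply, inner_sum]

theorem isSymmetric_sumOp :
    (sumOp ι E : PiLp 2 (fun _ : ι => E) →ₗ[ℝ] PiLp 2 (fun _ : ι => E)).IsSymmetric :=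
  fun w w' => by
    simp only [ContinuousLinearMap.coe_coe]
    rw [real_inner_comm (sumOp ι E w') w, inner_sumOp, inner_sumOp, real_inner_comm]

theorem sum_sum_map_sub_eq_zero {T : ι → ι → E →L[ℝ] E} (hT : ∀ i j, T i j = T j i)
    (a : ι → E) : ∑ i, ∑ j, T i j (a i - a j) = 0 := by
  simp only [map_sub, Finset.sum_sub_distrib]
  rw [sub_eq_zero]
  conv_rhs => rw [Finset.sum_comm]
  exact Finset.sum_congr rfl fun i _ => Finset.sum_congr rfl fun j _ => by rw [hT]

/-- The couplings cancel in the sum over the array, so the mean obeys the undamped equation and need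
not converge. Subtracting it leaves a damped system for the deviations, whose pairwise differences
are those of the `z i`. -/
theorem exists_pos_forall_tendsto_sub_zero [Nonempty ι] [FiniteDimensional ℝ E] {P : E →L[ℝ] E}
    {T S : ι → ι → E →L[ℝ] E} (hP : (P : E →ₗ[ℝ] E).IsSymmetric)
    (hPpos : ∀ x, x ≠ 0 → 0 < ⟪P x, x⟫_ℝ)
    (hT : ∀ i j, T i j = T j i) (hTs : ∀ i j, (T i j : E →ₗ[ℝ] E).IsSymmetric)
    (hTpos : ∀ i j x, 0 ≤ ⟪T i j x, x⟫_ℝ)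
    (hS : ∀ i j, S i j = S j i) (hSs : ∀ i j, (S i j : E →ₗ[ℝ] E).IsSymmetric)
    (hSpos : ∀ i j x, 0 ≤ ⟪S i j x, x⟫_ℝ)
    (hobs : ∀ (μ : ℝ) (w : ι → E), (∀ i, P (w i) = μ • w i) →
      (∀ i, ∑ j, T i j (w i - w j) = 0) → ∑ i, w i = 0 → w = 0) :
    ∃ r : ℝ, 0 < r ∧ ∀ ε : ℝ, 0 < ε → ε < r → ∀ z z' z'' : ι → ℝ → E,
      (∀ i t, HasDerivAt (z i) (z' i t) t) → (∀ i t, HasDerivAt (z' i) (z'' i t) t) →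
      (∀ i t, z'' i t + P (z i t) + ∑ j, T i j (z' i t - z' j t)
        + ε • ∑ j, S i j (z i t - z j t) = 0) →
      ∀ i j, Tendsto (fun t => z i t - z j t) atTop (𝓝 0) := by
  have hCpos : ∀ w, 0 ≤ ⟪(lapOp T + sumOp ι E) w, w⟫_ℝ := fun w => by
    rw [add_apply, inner_add_left, inner_sumOp]
    exact add_nonneg (inner_lapOp_self_nonneg hT hTpos w) real_inner_self_nonneg
  obtain ⟨r, hr, h⟩ := exists_pos_forall_no_eigenvector_in_ker (diagOp ι P) (lapOp S)
    (lapOp T + sumOp ι E) fun μ w hw hCw => by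
      have h0 : ⟪(lapOp T + sumOp ι E) w, w⟫_ℝ = 0 := by rw [hCw, inner_zero_left]
      rw [add_apply, inner_add_left, inner_sumOp] at h0
      -- Both summands of the form are nonnegative, so the kernel of the sum also annihilates each
      -- of them.
      have h1 : ∑ i, w i = 0 := inner_self_eq_zero.1 <|
        le_antisymm (by linarith [inner_lapOp_self_nonneg hT hTpos w]) real_inner_self_nonneg
      refine PiLp.ext fun i => congrFun (hobs μ (fun i => w i) (fun i => ?_) (fun i => ?_) h1) i
      · simpa using congrArg (fun u => u i) hw
      · simpa [h1] using congrArg (fun u => u i) hCw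
  refine ⟨r, hr, fun ε hε hεr z z' z'' hz hz' heq => ?_⟩
  set c : ℝ := (Fintype.card ι : ℝ)⁻¹ with hc
  have hcard : c * Fintype.card ι = 1 :=
    inv_mul_cancel₀ (Nat.cast_ne_zero.2 Fintype.card_ne_zero)
  let dev : (ι → ℝ → E) → ℝ → PiLp 2 (fun _ : ι => E) := fun a t =>
    WithLp.toLp 2 fun i => a i t - c • ∑ j, a j t
  have hdev : ∀ {a a' : ι → ℝ → E}, (∀ i t, HasDerivAt (a i) (a' i t) t) →
      ∀ t, HasDerivAt (dev a) (dev a' t) t := fun {a a'} ha t =>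
    (PiLp.continuousLinearEquiv 2 ℝ fun _ : ι => E).symm.hasFDerivAt.comp_hasDerivAt t
      (hasDerivAt_pi.2 fun i => (ha i t).sub
        ((HasDerivAt.fun_sum fun j _ => ha j t).const_smul c))
  have hdev_sub : ∀ (a : ι → ℝ → E) t i j, dev a t i - dev a t j = a i t - a j t :=
    fun a t i j => sub_sub_sub_cancel_right _ _ _
  have hdev_sum : ∀ (a : ι → ℝ → E) t, ∑ i, dev a t i = 0 := fun a t => by
    simp only [dev, Finset.sum_sub_distrib, Finset.sum_const, Finset.card_univ]
    rw [← Nat.cast_smul_eq_nsmul ℝ, smul_smul, mul_comm, hcard, one_smul, sub_self]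
  have hmean : ∀ t, ∑ i, z'' i t + P (∑ i, z i t) = 0 := fun t => by
    have := Finset.sum_eq_zero fun i (_ : i ∈ Finset.univ) => heq i t
    simp only [Finset.sum_add_distrib, ← Finset.smul_sum] at this
    rwa [sum_sum_map_sub_eq_zero hT (fun i => z' i t),
      sum_sum_map_sub_eq_zero hS (fun i => z i t), smul_zero, add_zero, add_zero,
      ← map_sum] at this
  have hA : (diagOp ι P + ε • lapOp S : PiLp 2 (fun _ : ι => E) →L[ℝ] _).toLinearMap.IsSymmetric :=
    fun w w' => by
      have h1 := isSymmetric_diagOp (ι := ι) hP w w'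
      have h2 := isSymmetric_lapOp hS hSs w w'
      simp only [ContinuousLinearMap.coe_coe] at h1 h2 ⊢
      simp only [add_apply, smul_apply, inner_add_left, inner_add_right,
        inner_smul_left, inner_smul_right, h1, h2, conj_trivial]
  have hApos : ∀ w, w ≠ 0 → 0 < ⟪(diagOp ι P + ε • lapOp S) w, w⟫_ℝ := fun w hw => by
    rw [add_apply, smul_apply, inner_add_left, inner_smul_left, conj_trivial]
    exact add_pos_of_pos_of_nonneg (inner_diagOp_self_pos hPpos hw)
      (mul_nonneg hε.le (inner_lapOp_self_nonneg hS hSpos w))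
  have hlim := tendsto_zero_of_damped hA hApos
    (C := lapOp T + sumOp ι E) ((isSymmetric_lapOp hT hTs).add isSymmetric_sumOp) hCpos
    (h ε hε hεr) (hdev hz) (hdev hz') fun t => by
      refine PiLp.ext fun i => ?_
      have h1 := heq i t
      have h2 := hmean t
      simp only [add_apply, smul_apply, PiLp.add_apply, PiLp.smul_apply, diagOp_apply,
        lapOp_apply, sumOp_apply, hdev_sub, hdev_sum, PiLp.zero_apply, add_zero]
      simp only [dev, map_sub P, map_smul]
      rw [eq_neg_of_add_eq_zero_right h2, ← h1]
      module
  intro i j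
  have hi := fun i => ((PiLp.proj 2 (fun _ : ι => E) i : _ →L[ℝ] E).continuous.tendsto 0).comp hlim
  refine (((hi i).sub (hi j)).congr fun t => hdev_sub z t i j).trans ?_
  simp

end Array

/-! ### Matrices as operators; eigenvectors for simple spectrum. -/

section MatrixOperators

variable {n : ℕ}

theorem real_inner_toEuclideanCLM_left (A : Matrix (Fin n) (Fin n) ℝ) (x y : EuclideanSpace ℝ (Fin n)) :
    ⟪Matrix.toEuclideanCLM (𝕜 := ℝ) A x, y⟫_ℝ = y.ofLp ⬝ᵥ (A *ᵥ x.ofLp) := by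
  simp [EuclideanSpace.inner_eq_star_dotProduct]

theorem Matrix.IsHermitian.isSymmetric_toEuclideanCLM {A : Matrix (Fin n) (Fin n) ℝ}
    (hA : A.IsHermitian) : (Matrix.toEuclideanCLM (𝕜 := ℝ) A : EuclideanSpace ℝ (Fin n) →ₗ[ℝ]
      EuclideanSpace ℝ (Fin n)).IsSymmetric :=
  Matrix.isSymmetric_toEuclideanLin_iff.2 hA

theorem Matrix.PosDef.inner_toEuclideanCLM_pos {A : Matrix (Fin n) (Fin n) ℝ} (hA : A.PosDef)
    (x : EuclideanSpace ℝ (Fin n)) (hx : x ≠ 0) :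
    0 < ⟪Matrix.toEuclideanCLM (𝕜 := ℝ) A x, x⟫_ℝ := by
  rw [real_inner_toEuclideanCLM_left]
  simpa using hA.dotProduct_mulVec_pos (x := x.ofLp) (by simpa using hx)

theorem Matrix.PosSemidef.inner_toEuclideanCLM_nonneg {A : Matrix (Fin n) (Fin n) ℝ}
    (hA : A.PosSemidef) (x : EuclideanSpace ℝ (Fin n)) :
    0 ≤ ⟪Matrix.toEuclideanCLM (𝕜 := ℝ) A x, x⟫_ℝ := by
  rw [real_inner_toEuclideanCLM_left]
  simpa using hA.dotProduct_mulVec_nonneg x.ofLp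

/-- With distinct eigenvalues, every family of eigenvectors of a symmetric matrix for one eigenvalue
is a family of multiples of one of the given eigenvectors. -/
theorem exists_eq_smul_of_eigenvectors {P : Matrix (Fin n) (Fin n) ℝ} (hP : P.IsHermitian)
    {σ : Fin n → ℝ} (hσ : Function.Injective σ) {v : Fin n → EuclideanSpace ℝ (Fin n)}
    (hv : ∀ k, ‖v k‖ = 1) (hPv : ∀ k, P *ᵥ (v k).ofLp = σ k • (v k).ofLp)
    {ι : Type*} {μ : ℝ} {w : ι → EuclideanSpace ℝ (Fin n)}
    (hw : ∀ i, Matrix.toEuclideanCLM (𝕜 := ℝ) P (w i) = μ • w i) (hne : w ≠ 0) :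
    ∃ (k : Fin n) (u : ι → ℝ), ∀ i, w i = u i • v k := by
  set T := Matrix.toEuclideanCLM (𝕜 := ℝ) P
  have hT : ∀ x y, ⟪T x, y⟫_ℝ = ⟪x, T y⟫_ℝ := hP.isSymmetric_toEuclideanCLM
  have hTv : ∀ k, T (v k) = σ k • v k := fun k => by
    refine PiLp.ext fun i => ?_
    have := congrFun (hPv k) i
    rwa [← Matrix.ofLp_toEuclideanCLM] at this
  have horth : Orthonormal ℝ v := ⟨hv, fun i j hij => by
    have h := hT (v i) (v j)
    rw [hTv, hTv, inner_smul_left, inner_smul_right, conj_trivial] at h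
    have : (σ i - σ j) * ⟪v i, v j⟫_ℝ = 0 := by linarith
    exact (mul_eq_zero.1 this).resolve_left (sub_ne_zero.2 (hσ.ne hij))⟩
  obtain ⟨i₀, hi₀⟩ := Function.ne_iff.1 hne
  have : Nonempty (Fin n) := by
    rcases isEmpty_or_nonempty (Fin n) with h | h
    · exact absurd (Subsingleton.elim _ _) hi₀
    · exact h
  have hspan : ⊤ ≤ Submodule.span ℝ (Set.range v) := by
    have h := (basisOfOrthonormalOfCardEqFinrank horth (by simp)).span_eq
    rw [coe_basisOfOrthonormalOfCardEqFinrank] at h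
    exact h.ge
  let b := OrthonormalBasis.mk horth hspan
  have hb : ∀ k, b k = v k := fun k => by simp [b]
  have hexp : ∀ x, x = ∑ k, ⟪v k, x⟫_ℝ • v k := fun x => by
    conv_lhs => rw [← b.sum_repr' x]
    simp only [hb]
  -- By symmetry `w i` has no component along `v k` unless `σ k = μ`, which injectivity of `σ`
  -- allows for one `k` only, the same for all `i`.
  have hcoef : ∀ i k, (σ k - μ) * ⟪v k, w i⟫_ℝ = 0 := fun i k => by
    have h := hT (v k) (w i)
    rw [hTv, hw, inner_smul_left, inner_smul_right, conj_trivial] at h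
    linarith
  obtain ⟨k, hk⟩ : ∃ k, ⟪v k, w i₀⟫_ℝ ≠ 0 := by
    by_contra! h
    exact hi₀ ((hexp _).trans (by simp [h]))
  have hμ : σ k = μ := sub_eq_zero.1 ((mul_eq_zero.1 (hcoef i₀ k)).resolve_right hk)
  refine ⟨k, fun i => ⟪v k, w i⟫_ℝ, fun i => ?_⟩
  conv_lhs => rw [hexp (w i)]
  refine Finset.sum_eq_single_of_mem k (Finset.mem_univ _) fun l _ hl => ?_
  have : ⟪v l, w i⟫_ℝ = 0 := (mul_eq_zero.1 (hcoef i l)).resolve_left <|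
    sub_ne_zero.2 fun h => hl (hσ (h.trans hμ.symm))
  rw [this, zero_smul]

end MatrixOperators

/-! ### The block Laplacian and its projections. -/

section Projection

variable {q n : ℕ}

theorem idKron_mulVec (v : Fin n → ℝ) (u : Fin q → ℝ) :
    idKron q v *ᵥ u = fun x => u x.1 * v x.2 := by
  ext x
  simp [idKron, Matrix.mulVec, dotProduct, Matrix.one_apply, mul_comm]

/-- Since `W i i = 0`, the term `j = i` can be included in the off-diagonal sum at no cost. -/
theorem lap_mulVec {W : Fin q → Fin q → Matrix (Fin n) (Fin n) ℝ} (hW : ∀ i, W i i = 0)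
    (w : Fin q → Fin n → ℝ) (x : Fin q × Fin n) :
    (lap W *ᵥ fun y => w y.1 y.2) x = (∑ j, W x.1 j *ᵥ (w x.1 - w j)) x.2 := by
  obtain ⟨i, a⟩ := x
  have h1 : ∀ j, ∑ b, lap W (i, a) (j, b) * w j b
      = (if i = j then ((∑ l, W i l) *ᵥ w i) a else 0) - (W i j *ᵥ w j) a := fun j => by
    by_cases hij : i = j
    · subst hij
      simp [lap, hW, Matrix.mulVec, dotProduct]
    · simp [lap, hij, Matrix.mulVec, dotProduct]
  calc (lap W *ᵥ fun y => w y.1 y.2) (i, a) = ∑ j, ∑ b, lap W (i, a) (j, b) * w j b := by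
        simp only [Matrix.mulVec, dotProduct, Fintype.sum_prod_type]
    _ = _ := by
        simp only [h1, Finset.sum_sub_distrib, Finset.sum_ite_eq, Finset.mem_univ, if_true,
          Matrix.mulVec_sub, Finset.sum_apply, Matrix.sum_mulVec, Pi.sub_apply]

theorem isHermitian_lap {W : Fin q → Fin q → Matrix (Fin n) (Fin n) ℝ} (hW : IsWeight W) :
    (lap W).IsHermitian := by
  have hs : ∀ i j a b, W i j a b = W i j b a := fun i j a b => by
    simpa using (hW.posSemidef i j).isHermitian.apply b a
  refine Matrix.IsHermitian.ext fun x y => ?_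
  simp only [lap, Matrix.of_apply, star_trivial]
  by_cases h : x.1 = y.1
  · rw [if_pos h.symm, if_pos h, h, Matrix.sum_apply, Matrix.sum_apply]
    exact Finset.sum_congr rfl fun l _ => hs _ _ _ _
  · rw [if_neg (Ne.symm h), if_neg h, hW.symm, hs]

theorem isHermitian_projLap {L : Matrix (Fin q × Fin n) (Fin q × Fin n) ℝ} (hL : L.IsHermitian)
    (v : Fin n → ℝ) : (projLap L v).IsHermitian := by
  have := Matrix.isHermitian_conjTranspose_mul_mul (idKron q v) hL
  rwa [Matrix.conjTranspose_eq_transpose_of_trivial] at this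

/-- Serves both the all-ones vector, where every difference vanishes, and the coefficients of an
undamped eigenvector. -/
theorem projLap_mulVec_eq_zero {W : Fin q → Fin q → Matrix (Fin n) (Fin n) ℝ}
    (hW : ∀ i, W i i = 0) {v : Fin n → ℝ} {u : Fin q → ℝ}
    (h : ∀ i, ∑ j, W i j *ᵥ (u i • v - u j • v) = 0) : projLap (lap W) v *ᵥ u = 0 := by
  have h0 : lap W *ᵥ (idKron q v *ᵥ u) = 0 := by
    rw [idKron_mulVec]
    ext x
    exact (lap_mulVec hW (fun i => u i • v) x).trans (by rw [h]; rfl)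
  rw [projLap, ← Matrix.mulVec_mulVec, ← Matrix.mulVec_mulVec, h0, Matrix.mulVec_zero]

end Projection

/-! ### Congruence by `M^(-1/2)`. -/

section Normalization

variable {n : ℕ} {M : Matrix (Fin n) (Fin n) ℝ}

theorem isHermitian_sqrt (M : Matrix (Fin n) (Fin n) ℝ) : (CFC.sqrt M).IsHermitian :=
  (Matrix.nonneg_iff_posSemidef.1 (CFC.sqrt_nonneg M)).isHermitian

theorem isHermitian_invSqrt (M : Matrix (Fin n) (Fin n) ℝ) : (invSqrt M).IsHermitian :=
  (isHermitian_sqrt M).inv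

theorem Matrix.PosDef.isUnit_sqrt (hM : M.PosDef) : IsUnit (CFC.sqrt M) := by
  have h : CFC.sqrt M * CFC.sqrt M = M :=
    CFC.sqrt_mul_sqrt_self M (Matrix.nonneg_iff_posSemidef.2 hM.posSemidef)
  have hu := hM.isUnit
  rw [← h] at hu
  exact isUnit_of_mul_isUnit_left hu

theorem Matrix.PosDef.invSqrt_mul_sqrt (hM : M.PosDef) : invSqrt M * CFC.sqrt M = 1 :=
  Matrix.nonsing_inv_mul _ ((Matrix.isUnit_iff_isUnit_det _).1 hM.isUnit_sqrt)

theorem Matrix.PosDef.invSqrt_mul_self (hM : M.PosDef) : invSqrt M * M = CFC.sqrt M := by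
  have h : CFC.sqrt M * CFC.sqrt M = M :=
    CFC.sqrt_mul_sqrt_self M (Matrix.nonneg_iff_posSemidef.2 hM.posSemidef)
  calc invSqrt M * M = invSqrt M * (CFC.sqrt M * CFC.sqrt M) := by rw [h]
    _ = CFC.sqrt M := by rw [← mul_assoc, hM.invSqrt_mul_sqrt, one_mul]

theorem Matrix.PosDef.normalized {K : Matrix (Fin n) (Fin n) ℝ} (hM : M.PosDef)
    (hK : K.PosDef) : (normalized M K).PosDef := by
  have hinj : Function.Injective (invSqrt M).mulVec := by
    refine Matrix.mulVec_injective_of_isUnit ?_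
    exact Matrix.isUnit_nonsing_inv_iff.2 hM.isUnit_sqrt
  have := hK.conjTranspose_mul_mul_same hinj
  rwa [(isHermitian_invSqrt M).eq] at this

theorem IsWeight.normalize {q : ℕ} {D : Fin q → Fin q → Matrix (Fin n) (Fin n) ℝ}
    (hD : IsWeight D) (M : Matrix (Fin n) (Fin n) ℝ) :
    IsWeight fun i j => invSqrt M * D i j * invSqrt M where
  posSemidef i j := by
    have := (hD.posSemidef i j).conjTranspose_mul_mul_same (invSqrt M)
    rwa [(isHermitian_invSqrt M).eq] at this
  symm i j := by rw [hD.symm]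
  diag i := by simp [hD.diag]

end Normalization

/-! ### Assembly of the synchronization theorem. -/

theorem mainTheorem6 (q n : ℕ) (hq : 2 ≤ q)
    (M K : Matrix (Fin n) (Fin n) ℝ) (hM : M.PosDef) (hK : K.PosDef)
    (D R : Fin q → Fin q → Matrix (Fin n) (Fin n) ℝ) (hD : IsWeight D) (hR : IsWeight R)
    (σ : Fin n → ℝ) (hσ : Function.Injective σ)
    (v : Fin n → EuclideanSpace ℝ (Fin n)) (hv : ∀ k, ‖v k‖ = 1)
    (hPv : ∀ k, normalized M K *ᵥ (v k).ofLp = σ k • (v k).ofLp)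
    (hG : ∀ k, 0 < eigRe ((projLap (dissLap M D) (v k).ofLp).map Complex.ofReal) ⟨1, hq⟩) :
    ∃ r : ℝ, 0 < r ∧ ∀ ε : ℝ, 0 < ε → ε < r →
      Synchronizes M K D (fun i j => ε • R i j) := by
  have : Nonempty (Fin q) := ⟨⟨0, by omega⟩⟩
  have hW := hD.normalize M
  have hW' := hR.normalize M
  have hP := hM.normalized hK
  obtain ⟨r, hr, h⟩ := exists_pos_forall_tendsto_sub_zero
    (P := Matrix.toEuclideanCLM (𝕜 := ℝ) (normalized M K))
    (T := fun i j => Matrix.toEuclideanCLM (𝕜 := ℝ) (invSqrt M * D i j * invSqrt M))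
    (S := fun i j => Matrix.toEuclideanCLM (𝕜 := ℝ) (invSqrt M * R i j * invSqrt M))
    hP.isHermitian.isSymmetric_toEuclideanCLM hP.inner_toEuclideanCLM_pos
    (fun i j => by rw [hD.symm])
    (fun i j => (hW.posSemidef i j).isHermitian.isSymmetric_toEuclideanCLM)
    (fun i j => (hW.posSemidef i j).inner_toEuclideanCLM_nonneg)
    (fun i j => by rw [hR.symm])
    (fun i j => (hW'.posSemidef i j).isHermitian.isSymmetric_toEuclideanCLM)
    (fun i j => (hW'.posSemidef i j).inner_toEuclideanCLM_nonneg)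
    fun μ w hw hLw hsum => by
      by_contra hne
      obtain ⟨k, u, hu⟩ := exists_eq_smul_of_eigenvectors hP.isHermitian hσ hv hPv hw hne
      have hvk : v k ≠ 0 := fun h0 => by simpa [h0] using hv k
      have hu0 : u = 0 := by
        refine eq_zero_of_eigRe_one_pos hq
          (isHermitian_projLap (isHermitian_lap hW) (v k).ofLp) (hG k)
          (projLap_mulVec_eq_zero hW.diag (by simp))
          (projLap_mulVec_eq_zero hW.diag fun i => ?_) ?_
        · have := congrArg WithLp.ofLp (hLw i)
          simpa only [WithLp.ofLp_sum, Matrix.ofLp_toEuclideanCLM, hu, WithLp.ofLp_sub,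
            WithLp.ofLp_smul, WithLp.ofLp_zero] using this
        · simp only [hu, ← Finset.sum_smul] at hsum
          exact (smul_eq_zero.1 hsum).resolve_right hvk
      exact hne (funext fun i => by simp [hu, hu0])
  refine ⟨r, hr, fun ε hε hεr x ⟨x', x'', hx, hx', heq⟩ i j => ?_⟩
  set B := Matrix.toEuclideanCLM (𝕜 := ℝ) (CFC.sqrt M) with hB
  set B' := Matrix.toEuclideanCLM (𝕜 := ℝ) (invSqrt M) with hB'
  have hB'B : ∀ y, B' (B y) = y := fun y => by
    have : B' * B = 1 := by rw [hB, hB', ← map_mul, hM.invSqrt_mul_sqrt, map_one]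
    exact congrArg (fun f => f y) this
  -- Because `B' B = 1`, the normalized equation for `B (x i t)` is `M^(-1/2)` applied to the
  -- original one.
  have hconj : ∀ (N : Matrix (Fin n) (Fin n) ℝ) y,
      Matrix.toEuclideanCLM (𝕜 := ℝ) (invSqrt M * N * invSqrt M) (B y)
        = B' (Matrix.toEuclideanCLM (𝕜 := ℝ) N y) := fun N y => by
    rw [map_mul, map_mul]
    exact congrArg (fun y => B' (Matrix.toEuclideanCLM (𝕜 := ℝ) N y)) (hB'B y)
  have hBM : ∀ y, B y = B' (Matrix.toEuclideanCLM (𝕜 := ℝ) M y) := fun y => by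
    have : B = B' * Matrix.toEuclideanCLM (𝕜 := ℝ) M := by
      rw [hB, hB', ← map_mul, hM.invSqrt_mul_self]
    exact congrArg (fun f => f y) this
  have hlim := h ε hε hεr (fun i t => B (x i t)) (fun i t => B (x' i t)) (fun i t => B (x'' i t))
    (fun i t => B.hasFDerivAt.comp_hasDerivAt t (hx i t))
    (fun i t => B.hasFDerivAt.comp_hasDerivAt t (hx' i t))
    (fun i t => by
      have hvec : Matrix.toEuclideanCLM (𝕜 := ℝ) M (x'' i t)
          + Matrix.toEuclideanCLM (𝕜 := ℝ) K (x i t)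
          + ∑ j, Matrix.toEuclideanCLM (𝕜 := ℝ) (D i j) (x' i t - x' j t)
          + ε • ∑ j, Matrix.toEuclideanCLM (𝕜 := ℝ) (R i j) (x i t - x j t) = 0 := by
        refine WithLp.ofLp_injective 2 ?_
        have := heq i t
        simpa only [WithLp.ofLp_add, WithLp.ofLp_sum, WithLp.ofLp_smul, WithLp.ofLp_zero,
          Matrix.ofLp_toEuclideanCLM, Finset.smul_sum, Matrix.smul_mulVec] using this
      have := congrArg B' hvec
      simp only [map_add, map_sum B', map_smul B', map_zero B'] at this
      simp only [← map_sub B, normalized, hconj]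
      rwa [hBM (x'' i t)])
    i j
  -- Applying the continuous map `B'` carries the limit back from `B x` to `x`.
  have := ((B'.continuous.tendsto 0).comp hlim).norm
  rw [map_zero, norm_zero] at this
  refine this.congr fun t => ?_
  simp only [Function.comp_apply, ← map_sub B, hB'B]
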